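/- Let $\mathfrak S_n$ be the set of permutations of $\{1,\dots,n\}$. For $\pi=\pi_1\cdots\pi_n\in\mathfrak S_n$ let $\operatorname{ides}(\pi)$ be the number of $i\in\{1,\dots,n-1\}$ with $\pi^{-1}(i)>\pi^{-1}(i+1)$, and for $m\ge 2$ let $\operatorname{occ}_{12\cdots m}(\pi)$ be the number of occurrences in $\pi$ of the consecutive pattern $12\cdots m$, that is, the number of $i\in\{1,\dots,n-m+1\}$ with $\pi_i<\pi_{i+1}<\cdots<\pi_{i+m-1}$. Put $$A^{\operatorname{ides}}_{12\cdots m,n}(s,t)=\sum_{\pi\in\mathfrak S_n}s^{\operatorname{occ}_{12\cdots m}(\pi)}t^{\operatorname{ides}(\pi)+1}\quad(n\ge 1),\qquad A^{\operatorname{ides}}_{12\cdots m,0}(s,t)=1,$$ and $A^{\operatorname{ides}}_{12\cdots m,n}(t)=A^{\operatorname{ides}}_{12\cdots m,n}(0,t)$. For a formal power series $f=\sum_{k\ge0}f_kt^k$ whose coefficients $f_k$ are power series in the other variables, let $f^{*\langle n\rangle}=\sum_{k\ge 0}f_k^{\,n}t^k$ be its $n$-th Hadamard power in $t$; in particular $f^{*\langle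 0\rangle}=1/(1-t)$. **Theorem 4.3.** Let $m\ge 2$ and $z=x/(1-t)$. As formal power series over $\mathbb Q$ (all sums below being formally convergent and all the inverses existing): (a) $$\sum_{n=0}^\infty\frac{A^{\operatorname{ides}}_{12\cdots m,n}(s,t)}{(1-t)^{n+1}}x^n=\sum_{n=0}^\infty\left(\frac{tx}{(1-t)^2}+\frac{(s-1)\,t\,z^m}{(1-t)\bigl(1-(s-1)\sum_{l=1}^{m-1}z^l\bigr)}\right)^{*\langle n\rangle};$$ (b) $$\sum_{n=0}^\infty\frac{A^{\operatorname{ides}}_{12\cdots m,n}(t)}{(1-t)^{n+1}}x^n=\sum_{n=0}^\infty\left(\frac{t\,z\,(1-z^{m-1})}{(1-t)(1-z^m)}\right)^{*\langle n\rangle};$$ (c) $$\sum_{n=0}^\infty\frac{A^{\operatorname{ides}}_{12\cdots m,n}(t)}{(1-t)^{n+1}}x^n=1+\sum_{k=1}^\infty\left[\sum_{j=0}^\infty\left(\binom{k+jm-1}{k-1}x^{jm}-\binom{k+jm}{k-1}x^{jm+1}\right)\right]^{-1}t^k.$$ -/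

import Mathlib

open PowerSeries

namespace ConsecutivePatterns

/-! ### Permutations, descents, consecutive patterns

A permutation of `[n]` is an element of `Equiv.Perm (Fin n)`; positions and letters are shifted
by one, so they run from `0` to `n - 1`. -/

/-- The descent number: the number of positions `i` with a successor `i + 1` such that
`π i > π (i + 1)`. -/
def des {n : ℕ} (π : Equiv.Perm (Fin n)) : ℕ :=
  (Finset.univ.filter fun i : Fin n =>
    ∃ h : (i : ℕ) + 1 < n, π ⟨(i : ℕ) + 1, h⟩ < π i).card

/-- The inverse descent number. -/
def ides {n : ℕ} (π : Equiv.Perm (Fin n)) : ℕ := des π⁻¹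

/-- Standardization of a word of length `m` with distinct letters: the smallest letter is replaced
by `0`, the second smallest by `1`, and so on, i.e. each letter is replaced by the number of letters
of the word smaller than it. -/
def std {m : ℕ} (w : Fin m → ℕ) : Fin m → ℕ := fun a =>
  (Finset.univ.filter fun b : Fin m => w b < w a).card

/-- The factor of length `m` of `π` that starts at position `i`. -/
def factor {n m : ℕ} (π : Equiv.Perm (Fin n)) (i : ℕ) (h : i + m ≤ n) : Fin m → ℕ := fun a =>
  (π ⟨i + (a : ℕ), lt_of_lt_of_le (Nat.add_lt_add_left a.isLt i) h⟩ : ℕ)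

/-- The number of occurrences of `σ` in `π` as a consecutive pattern. -/
def occ {m n : ℕ} (σ : Equiv.Perm (Fin m)) (π : Equiv.Perm (Fin n)) : ℕ :=
  ((Finset.range (n + 1)).filter fun i =>
    ∃ h : i + m ≤ n, ∀ a : Fin m, std (factor π i h) a = (σ a : ℕ)).card

/-- The monotone pattern `12⋯m`. -/
def monotonePattern (m : ℕ) : Equiv.Perm (Fin m) := 1

/-- The polynomial `A_{σ,n}^{ides}(s,t) = ∑_π s^{occ_σ(π)} t^{ides(π)+1}` for `n ≥ 1`, and `1` for
`n = 0`, evaluated at elements `s`, `t` of a commutative ring. -/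
def idesPoly {A : Type*} [CommRing A] {m : ℕ} (σ : Equiv.Perm (Fin m)) (n : ℕ) (s t : A) : A :=
  if n = 0 then 1 else ∑ π : Equiv.Perm (Fin n), s ^ occ σ π * t ^ (ides π + 1)

/-- The polynomial `A_{σ,n}^{ides}(t) = A_{σ,n}^{ides}(0,t)` counting the permutations that
avoid `σ`. -/
def idesPolyAvoid {A : Type*} [CommRing A] {m : ℕ} (σ : Equiv.Perm (Fin m)) (n : ℕ) (t : A) : A :=
  idesPoly σ n 0 t

/-! ### Formal power series in `x` and `t`

`R⟦x,t⟧` is realized as `(R⟦x⟧)⟦t⟧`: the outer variable is `t`, the inner one `x`. -/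

noncomputable section

variable (R : Type*) [CommRing R]

/-- The variable `t`. -/
def tVar : R⟦X⟧⟦X⟧ := PowerSeries.X

/-- The variable `x`. -/
def xVar : R⟦X⟧⟦X⟧ := PowerSeries.C PowerSeries.X

/-- The variable `s` of `ℚ⟦s,x,t⟧`, realized as `((ℚ⟦s⟧)⟦x⟧)⟦t⟧`. -/
def sVar : ℚ⟦X⟧⟦X⟧⟦X⟧ := PowerSeries.C (PowerSeries.C PowerSeries.X)

/-- The quotient `f / g` of elements of a commutative ring, for `g` a unit. -/
def quo {A : Type*} [CommRing A] (f g : A) : A := f * Ring.inverse g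

/-- `z = x / (1 - t)`. -/
def zVar : R⟦X⟧⟦X⟧ := quo (xVar R) (1 - tVar R)

variable {R}

/-- Hadamard product in the (outer) variable `t`; the coefficients, which may themselves be power
series in other variables, are multiplied as usual. -/
def hadamard {A : Type*} [CommRing A] (f g : A⟦X⟧) : A⟦X⟧ :=
  PowerSeries.mk fun k => PowerSeries.coeff k f * PowerSeries.coeff k g

/-- The `n`-fold Hadamard product of `f` with itself; for `n = 0` it is the identity
`∑ t^k = 1 / (1 - t)` of the Hadamard product. -/
def hadamardPow {A : Type*} [CommRing A] (f : A⟦X⟧) : ℕ → A⟦X⟧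
  | 0 => PowerSeries.mk fun _ => 1
  | n + 1 => hadamard (hadamardPow f n) f

/-- A sequence of series in one variable is formally summable if only finitely many terms contribute
to each coefficient. -/
def Summable₁ (f : ℕ → R⟦X⟧) : Prop :=
  ∀ i : ℕ, (Function.support fun n => PowerSeries.coeff i (f n)).Finite

/-- The coefficientwise sum of a formally summable sequence of series in one variable. -/
def formalSum₁ (f : ℕ → R⟦X⟧) : R⟦X⟧ :=
  PowerSeries.mk fun i => ∑ᶠ n, PowerSeries.coeff i (f n)

/-- A sequence of series in `x` and `t` is formally summable if only finitely many terms contribute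
to each coefficient (of `x ^ j * t ^ k`). -/
def Summable₂ (f : ℕ → R⟦X⟧⟦X⟧) : Prop :=
  ∀ k j : ℕ, (Function.support fun n => PowerSeries.coeff j (PowerSeries.coeff k (f n))).Finite

/-- The coefficientwise sum of a formally summable sequence of series in `x` and `t`. -/
def formalSum₂ (f : ℕ → R⟦X⟧⟦X⟧) : R⟦X⟧⟦X⟧ :=
  PowerSeries.mk fun k => PowerSeries.mk fun j =>
    ∑ᶠ n, PowerSeries.coeff j (PowerSeries.coeff k (f n))

/-! ### The series of the monotone pattern -/

/-- The `n`-th term `A_{12⋯m,n}^{ides}(s,t) x^n / (1-t)^{n+1}`. -/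
def idesTerm (m : ℕ) (s : R⟦X⟧⟦X⟧) (n : ℕ) : R⟦X⟧⟦X⟧ :=
  quo (idesPoly (monotonePattern m) n s (tVar R)) ((1 - tVar R) ^ (n + 1)) * xVar R ^ n

/-- The `n`-th term `A_{12⋯m,n}^{ides}(t) x^n / (1-t)^{n+1}`. -/
def idesAvoidTerm (R : Type*) [CommRing R] (m n : ℕ) : R⟦X⟧⟦X⟧ :=
  quo (idesPolyAvoid (monotonePattern m) n (tVar R)) ((1 - tVar R) ^ (n + 1)) * xVar R ^ n

/-- `tx / (1-t)^2 + (s-1) t z^m / ((1-t) (1 - (s-1) ∑_{l=1}^{m-1} z^l))`. -/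
def occSeries (m : ℕ) (s : R⟦X⟧⟦X⟧) : R⟦X⟧⟦X⟧ :=
  quo (tVar R * xVar R) ((1 - tVar R) ^ 2) +
    quo ((s - 1) * tVar R * zVar R ^ m)
      ((1 - tVar R) * (1 - (s - 1) * ∑ l ∈ Finset.Icc 1 (m - 1), zVar R ^ l))

/-- `t z (1 - z^{m-1}) / ((1-t) (1-z^m))`. -/
def avoidSeries (R : Type*) [CommRing R] (m : ℕ) : R⟦X⟧⟦X⟧ :=
  quo (tVar R * zVar R * (1 - zVar R ^ (m - 1))) ((1 - tVar R) * (1 - zVar R ^ m))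

/-- `C(k+jm-1, k-1) x^{jm} - C(k+jm, k-1) x^{jm+1}`, for `k ≥ 1`, as a series in `x`. -/
def binomTerm (m k j : ℕ) : ℚ⟦X⟧ :=
  ((k + j * m - 1).choose (k - 1) : ℚ⟦X⟧) * PowerSeries.X ^ (j * m) -
    ((k + j * m).choose (k - 1) : ℚ⟦X⟧) * PowerSeries.X ^ (j * m + 1)

/-! ### The denominators are units, so the quotients above are genuine -/

theorem isUnit_one_sub (f : R⟦X⟧⟦X⟧)
    (h : PowerSeries.constantCoeff (PowerSeries.constantCoeff f) = 0) : IsUnit (1 - f) := by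
  rw [PowerSeries.isUnit_iff_constantCoeff, PowerSeries.isUnit_iff_constantCoeff]
  simp [h]

theorem isUnit_one_sub_tVar : IsUnit (1 - tVar R) :=
  isUnit_one_sub _ (by simp [tVar])

theorem constantCoeff_zVar :
    PowerSeries.constantCoeff (PowerSeries.constantCoeff (zVar R)) = 0 := by
  simp [zVar, quo, xVar]

theorem isUnit_occSeries_denominator (m : ℕ) (s : R⟦X⟧⟦X⟧) :
    IsUnit ((1 - tVar R) * (1 - (s - 1) * ∑ l ∈ Finset.Icc 1 (m - 1), zVar R ^ l)) := by
  refine isUnit_one_sub_tVar.mul (isUnit_one_sub _ ?_)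
  have : ∑ l ∈ Finset.Icc 1 (m - 1), (0 : R) ^ l = 0 :=
    Finset.sum_eq_zero fun l hl => zero_pow (by have := Finset.mem_Icc.1 hl; omega)
  simp [constantCoeff_zVar, this]

theorem isUnit_avoidSeries_denominator (m : ℕ) (hm : m ≠ 0) :
    IsUnit ((1 - tVar R) * (1 - zVar R ^ m)) :=
  isUnit_one_sub_tVar.mul (isUnit_one_sub _ (by simp [constantCoeff_zVar, hm]))

end

end ConsecutivePatterns

/-! Both sides are compared at each power of `t`. The coefficient of `t ^ k` turns out to be the
generating function of words over `k` letters, with `s` marking the weakly increasing windows of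
length `m` (`wordSum`).

Left side: standardization (the inverse of the stable sort) sends words to permutations and keeps
weak ascents, hence windows. The words over `k` letters that standardize to `π` number `(k +
e).choose n`, where `e` counts the non-descents of `π⁻¹`. This is the coefficient of `t ^ k` in `t ^
(ides π + 1) / (1 - t) ^ (n + 1)` (`wordSum_succ`, `coeff_quo_idesPoly`).

Right side: let `g` be inverse to `∑ s ^ (r + 1 - m) x ^ r` (truncated exponent), the series of
weights of single runs. Weighting each coefficient `g_l` by the number of weakly increasing words of
length `l` gives the inverse of the word series, because the ways of splitting a weakly increasing
suffix off a fixed word cancel (`mk_wordSum_mul_eq_one`). The map `spread` performs this weighting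
for all `k ≥ 1` at once and turns `1 - g` into `occSeries`; summing Hadamard powers is then a
geometric series in each coefficient. Parts (b) and (c) are the case `s = 0`, where `g = (1 - x) /
(1 - x ^ m)`. -/

namespace ConsecutivePatterns

/-! ### Windows, runs and cancellation over suffixes -/

open Finset in
/-- The number of windows of length `m` in `0, …, n - 1` on which `P` holds at every position
except possibly the last. -/
noncomputable def windowCount (m : ℕ) (P : ℕ → Prop) (n : ℕ) : ℕ :=
  open Classical in
  ((range (n + 1)).filter fun i => i + m ≤ n ∧ ∀ a, a + 1 < m → P (i + a)).card

theorem windowCount_succ {m : ℕ} (hm : 1 ≤ m) (P : ℕ → Prop) (n : ℕ) [Decidable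
    (m ≤ n + 1 ∧ ∀ a, a + 1 < m → P (n + 1 - m + a))] :
    windowCount m P (n + 1) = windowCount m P n +
      if m ≤ n + 1 ∧ ∀ a, a + 1 < m → P (n + 1 - m + a) then 1 else 0 := by
  classical
  unfold windowCount
  split_ifs with h
  · rw [← Finset.card_insert_of_notMem (a := n + 1 - m)]
    · congr 1
      ext i
      simp only [Finset.mem_filter, Finset.mem_range, Finset.mem_insert]
      constructor
      · rintro ⟨h1, h2, h3⟩
        by_cases hi : i = n + 1 - m
        · exact Or.inl hi
        · exact Or.inr ⟨by omega, by omega, h3⟩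
      · rintro (rfl | ⟨h1, h2, h3⟩)
        · exact ⟨by omega, by omega, h.2⟩
        · exact ⟨by omega, by omega, h3⟩
    · simp only [Finset.mem_filter, Finset.mem_range, not_and]
      omega
  · rw [add_zero]
    congr 1
    ext i
    simp only [Finset.mem_filter, Finset.mem_range]
    constructor
    · rintro ⟨h1, h2, h3⟩
      refine ⟨by omega, ?_, h3⟩
      by_contra hi
      have hi' : i = n + 1 - m := by omega
      subst hi'
      exact h ⟨by omega, h3⟩
    · rintro ⟨h1, h2, h3⟩
      exact ⟨by omega, by omega, h3⟩

theorem windowCount_zero {m : ℕ} (hm : 1 ≤ m) (P : ℕ → Prop) : windowCount m P 0 = 0 := by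
  simp [windowCount, Finset.filter_eq_empty_iff]
  omega

theorem windowCount_congr {m n : ℕ} {P Q : ℕ → Prop} (h : ∀ i, i + 1 < n → (P i ↔ Q i)) :
    windowCount m P n = windowCount m Q n := by
  classical
  unfold windowCount
  congr 1
  ext i
  simp only [Finset.mem_filter]
  refine and_congr_right fun _ => and_congr_right fun h2 => forall₂_congr fun a ha => h _ (by omega)

/-- The number of windows after a maximal run of `P`. -/
theorem windowCount_add_run {m : ℕ} (hm : 1 ≤ m) {P : ℕ → Prop} {p r : ℕ}
    (hp : p = 0 ∨ ¬ P (p - 1)) (h : ∀ j, p ≤ j → j + 1 < p + r → P j) :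
    windowCount m P (p + r) = windowCount m P p + (r + 1 - m) := by
  classical
  induction r with
  | zero => simp; omega
  | succ r ih =>
    rw [← add_assoc, windowCount_succ hm, ih fun j h1 h2 => h j h1 (by omega)]
    by_cases hr : m ≤ r + 1
    · rw [if_pos ⟨by omega, fun a ha => h _ (by omega) (by omega)⟩]
      omega
    · rw [if_neg]
      · omega
      rintro ⟨h1, h2⟩
      rcases hp with rfl | hp
      · omega
      · apply hp
        by_cases hp0 : p = 0
        · omega
        -- Since `m > r + 1`, the window starts before `p`; this offset is the one at which it meets
        -- position `p - 1`, where `P` fails.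
        have := h2 (m - 2 - r) (by omega)
        rwa [show p + r + 1 - m + (m - 2 - r) = p - 1 by omega] at this

/-- Summing over all ways to split off a suffix that is a run of `P`, with coefficients `g` inverse
to the weights `s ^ (r + 1 - m)` of runs of length `r`, gives zero. -/
theorem sum_antidiagonal_run_eq_zero {R : Type*} [CommRing R] {m : ℕ} (hm : 1 ≤ m) (s : R)
    (g : ℕ → R)
    (hg : ∀ r, r ≠ 0 → ∑ x ∈ Finset.HasAntidiagonal.antidiagonal r, g x.1 * s ^ (x.2 + 1 - m) = 0)
    (P : ℕ → Prop) {n : ℕ} (hn : n ≠ 0)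
    [DecidablePred fun p => ∀ j, p ≤ j → j + 1 < n → P j] :
    ∑ x ∈ Finset.HasAntidiagonal.antidiagonal n,
      (if ∀ j, x.2 ≤ j → j + 1 < n → P j then g x.1 * s ^ windowCount m P x.2 else 0) = 0 := by
  have hex : ∃ p, ∀ j, p ≤ j → j + 1 < n → P j := ⟨n, fun j _ _ => by omega⟩
  obtain ⟨p, hp, hmin⟩ : ∃ p, (∀ j, p ≤ j → j + 1 < n → P j) ∧
      ∀ q, (∀ j, q ≤ j → j + 1 < n → P j) → p ≤ q :=
    ⟨Nat.find hex, Nat.find_spec hex, fun q hq => Nat.find_min' hex hq⟩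
  -- A single last letter is always a run, so `n - p` is nonzero, as `hg` requires.
  have hpn : p ≤ n - 1 := hmin _ fun j _ _ => by omega
  have hp' : p = 0 ∨ ¬ P (p - 1) := by
    by_contra! hc
    have := hmin (p - 1) fun j h1 h2 => by
      rcases h1.eq_or_lt with rfl | h
      · exact hc.2
      · exact hp _ (by omega) h2
    omega
  have hiff : ∀ q, (∀ j, q ≤ j → j + 1 < n → P j) ↔ p ≤ q := fun q =>
    ⟨hmin q, fun hq j h1 h2 => hp j (by omega) h2⟩
  rw [← Finset.sum_filter]
  -- The admissible cuts are exactly those inside the last maximal run, and all share the windows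
  -- before `p`.
  have hrw : ∑ x ∈ Finset.HasAntidiagonal.antidiagonal n with ∀ j, x.2 ≤ j → j + 1 < n → P j,
      g x.1 * s ^ windowCount m P x.2 =
      ∑ x ∈ Finset.HasAntidiagonal.antidiagonal (n - p),
        s ^ windowCount m P p * (g x.1 * s ^ (x.2 + 1 - m)) := by
    symm
    refine Finset.sum_bij (fun x _ => (x.1, p + x.2)) ?_ ?_ ?_ ?_
    · rintro ⟨a, b⟩ h
      simp only [Finset.HasAntidiagonal.mem_antidiagonal, Finset.mem_filter, hiff] at h ⊢
      omega
    · rintro ⟨a, b⟩ _ ⟨a', b'⟩ _ h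
      simp only [Prod.mk.injEq] at h ⊢
      omega
    · rintro ⟨a, b⟩ h
      simp only [Finset.HasAntidiagonal.mem_antidiagonal, Finset.mem_filter, hiff] at h
      refine ⟨(a, b - p), ?_, ?_⟩
      · simp only [Finset.HasAntidiagonal.mem_antidiagonal]; omega
      · exact Prod.ext rfl (by simp only; omega)
    · rintro ⟨a, b⟩ h
      simp only [Finset.HasAntidiagonal.mem_antidiagonal] at h
      simp only
      rw [windowCount_add_run hm hp' fun j h1 h2 => hp j h1 (by omega), pow_add]
      ring
  rw [hrw, ← Finset.mul_sum, hg _ (by omega), mul_zero]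

/-! ### Counting words by their standardization -/

theorem card_strictMono (n N : ℕ) [DecidablePred fun g : Fin n → Fin N => StrictMono g] :
    (Finset.univ.filter fun g : Fin n → Fin N => StrictMono g).card = N.choose n := by
  have e : {g : Fin n → Fin N // StrictMono g} ≃ Set.powersetCard (Fin N) n :=
    Equiv.trans ⟨fun g => OrderEmbedding.ofStrictMono g.1 g.2, fun f => ⟨f, f.strictMono⟩,
      fun _ => rfl, fun _ => rfl⟩ Set.powersetCard.ofFinEmbEquiv
  rw [← Fintype.card_subtype, ← Nat.card_eq_fintype_card, Nat.card_congr e,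
    Set.powersetCard.card, Nat.card_fin]

/-- The number of weakly increasing sequences in `Fin k` with prescribed positions of strict
increase. -/
theorem card_monotone_strict_at (N k : ℕ) (D : ℕ → Prop) [DecidablePred D] :
    (Finset.univ.filter fun g : Fin (N + 1) → Fin k => ∀ i : Fin N,
      g i.castSucc ≤ g i.succ ∧ (D i → g i.castSucc < g i.succ)).card =
      (k + Nat.count (fun j => ¬ D j) N).choose (N + 1) := by
  classical
  set e : ℕ → ℕ := Nat.count (fun j => ¬ D j) with he
  have hes : ∀ i, e (i + 1) = e i + if D i then 0 else 1 := fun i => by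
    rw [he, Nat.count_succ]; split_ifs <;> simp_all
  have hmono : Monotone e := Nat.count_monotone _
  rw [← card_strictMono]
  -- Adding the number of earlier positions where equality is allowed makes every increase strict.
  refine Finset.card_bij (fun g _ i => ⟨g i + e i, ?_⟩) ?_ ?_ ?_
  · have := hmono (show (i : ℕ) ≤ N by omega)
    omega
  · intro g hg
    simp only [Finset.mem_filter, Finset.mem_univ, true_and] at hg ⊢
    rw [Fin.strictMono_iff_lt_succ]
    intro i
    have h1 := (hg i).1
    have h2 := (hg i).2
    rw [Fin.lt_def]
    rw [Fin.le_def] at h1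
    rw [Fin.lt_def] at h2
    simp only [Fin.val_succ, Fin.val_castSucc, hes]
    split_ifs with h
    · have := h2 h; omega
    · omega
  · intro g _ g' _ h
    ext i
    have := congrArg Fin.val (congrFun h i)
    simp only at this
    omega
  · intro f hf
    simp only [Finset.mem_filter, Finset.mem_univ, true_and] at hf
    have hf' := Fin.strictMono_iff_lt_succ.1 hf
    -- Each step raises `f` by at least one and `e` by at most one, so the subtraction `f - e` never
    -- truncates.
    have hlow : ∀ i : Fin (N + 1), e i ≤ f i := by
      intro i
      induction i using Fin.induction with
      | zero => simp [he]
      | succ i ih =>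
        have := hf' i
        rw [Fin.lt_def] at this
        simp only [Fin.val_succ, Fin.val_castSucc, hes] at ih ⊢
        split_ifs <;> omega
    have hm : Monotone fun i : Fin (N + 1) => (f i : ℕ) - e i := by
      rw [Fin.monotone_iff_le_succ]
      intro i
      have := hf' i
      rw [Fin.lt_def] at this
      simp only [Fin.val_succ, Fin.val_castSucc, hes]
      split_ifs <;> omega
    have hk : ∀ i, (f i : ℕ) - e i < k := by
      intro i
      have h1 := hm (Fin.le_last i)
      have h2 := (f (Fin.last N)).2
      have h3 := hlow (Fin.last N)
      simp only [Fin.val_last] at h1 h3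
      omega
    refine ⟨fun i => ⟨f i - e i, hk i⟩, ?_, ?_⟩
    · simp only [Finset.mem_filter, Finset.mem_univ, true_and]
      intro i
      have h1 := hf' i
      have h2 := hlow i.castSucc
      have h3 := hlow i.succ
      rw [Fin.lt_def] at h1
      simp only [Fin.val_succ, Fin.val_castSucc, hes, Fin.le_def, Fin.lt_def] at h2 h3 ⊢
      split_ifs at h3 ⊢ with h
      · exact ⟨by omega, fun _ => by omega⟩
      · exact ⟨by omega, fun h' => absurd h' h⟩
    · ext i
      have := hlow i
      simp only
      omega

/-- The word `w` has a weak ascent at position `i`. -/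
def WeakAscent {α : Type*} [LE α] {n : ℕ} (w : Fin n → α) (i : ℕ) : Prop :=
  ∃ h : i + 1 < n, w ⟨i, by omega⟩ ≤ w ⟨i + 1, h⟩

theorem std_eq_self_iff_strictMono {m : ℕ} (w : Fin m → ℕ) :
    (∀ a, std w a = (a : ℕ)) ↔ StrictMono w := by
  constructor
  · intro h a b hab
    by_contra! hc
    have : std w b ≤ std w a := by
      refine Finset.card_le_card fun c => ?_
      simp only [Finset.mem_filter, Finset.mem_univ, true_and]
      exact fun h => h.trans_le hc
    rw [h, h] at this
    exact absurd hab (by rw [Fin.lt_def]; omega)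
  · intro h a
    simp only [std, h.lt_iff_lt]
    rw [show (Finset.univ.filter fun b : Fin m => b < a) = Finset.Iio a by ext; simp, Fin.card_Iio]

/-- Letters of a permutation are distinct, so weak ascents are strict; one predicate then serves
both words and permutations. -/
theorem strictMono_factor_iff {m n : ℕ} (π : Equiv.Perm (Fin n)) (i : ℕ) (h : i + m ≤ n) :
    StrictMono (factor π i h) ↔ ∀ a, a + 1 < m → WeakAscent π (i + a) := by
  cases m with
  | zero => simp [StrictMono]
  | succ m =>
    rw [Fin.strictMono_iff_lt_succ]
    constructor
    · intro H a ha
      exact ⟨by omega, (H ⟨a, by omega⟩).le⟩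
    · intro H a
      obtain ⟨h1, h2⟩ := H a (by omega)
      refine lt_of_le_of_ne h2 fun heq => ?_
      have := π.injective (Fin.ext heq)
      simp only [Fin.mk.injEq, Fin.val_castSucc, Fin.val_succ] at this
      omega

theorem occ_monotonePattern {m n : ℕ} (π : Equiv.Perm (Fin n)) :
    occ (monotonePattern m) π = windowCount m (WeakAscent π) n := by
  classical
  unfold occ windowCount
  congr 1
  ext i
  simp only [Finset.mem_filter]
  refine and_congr_right fun _ => ?_
  simp only [monotonePattern, Equiv.Perm.coe_one, id, std_eq_self_iff_strictMono,
    strictMono_factor_iff, exists_prop]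

/-- Stability of the sort: its inverse ranks equal letters from left to right, so a tie becomes an
ascent. -/
theorem sort_symm_lt_iff {α : Type*} [LinearOrder α] {n : ℕ} (w : Fin n → α) {i j : Fin n}
    (hij : i < j) : (Tuple.sort w)⁻¹ i < (Tuple.sort w)⁻¹ j ↔ w i ≤ w j := by
  obtain ⟨h1, h2⟩ := Tuple.eq_sort_iff.1 (rfl : Tuple.sort w = Tuple.sort w)
  set σ := Tuple.sort w
  obtain ⟨a, rfl⟩ := σ.surjective i
  obtain ⟨b, rfl⟩ := σ.surjective j
  rw [Equiv.Perm.inv_def, σ.symm_apply_apply, σ.symm_apply_apply]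
  constructor
  · exact fun h => h1 h.le
  · intro h
    by_contra! hc
    rcases hc.eq_or_lt with rfl | hc
    · exact lt_irrefl _ hij
    · exact lt_asymm hij (h2 b a hc (le_antisymm (h1 hc.le) h))

theorem weakAscent_sort_symm {α : Type*} [LinearOrder α] {n : ℕ} (w : Fin n → α) (i : ℕ) :
    WeakAscent ⇑(Tuple.sort w)⁻¹ i ↔ WeakAscent w i := by
  refine exists_congr fun h => ?_
  have hlt : (⟨i, by omega⟩ : Fin n) < ⟨i + 1, h⟩ := by simp [Fin.lt_def]
  rw [← sort_symm_lt_iff w hlt]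
  refine ⟨fun h' => lt_of_le_of_ne h' fun h'' => hlt.ne ((Tuple.sort w)⁻¹.injective h''), le_of_lt⟩

/-- Position `i` is a descent of `σ`. -/
def DescentAt {n : ℕ} (σ : Equiv.Perm (Fin n)) (i : ℕ) : Prop :=
  ∃ h : i + 1 < n, σ ⟨i + 1, h⟩ < σ ⟨i, by omega⟩

instance {n : ℕ} (σ : Equiv.Perm (Fin n)) : DecidablePred (DescentAt σ) := fun _ =>
  inferInstanceAs (Decidable (∃ _, _))

theorem des_eq_count {N : ℕ} (σ : Equiv.Perm (Fin (N + 1))) :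
    des σ = Nat.count (DescentAt σ) N := by
  rw [Nat.count_eq_card_filter_range, des]
  refine Finset.card_bij (fun i _ => (i : ℕ)) ?_ (fun _ _ _ _ => Fin.ext) ?_
  · intro i hi
    obtain ⟨h, hi⟩ := (Finset.mem_filter.1 hi).2
    exact Finset.mem_filter.2 ⟨Finset.mem_range.2 (by omega), h, hi⟩
  · intro i hi
    obtain ⟨h, hi⟩ := (Finset.mem_filter.1 hi).2
    exact ⟨⟨i, by omega⟩, Finset.mem_filter.2 ⟨Finset.mem_univ _, h, hi⟩, rfl⟩

theorem sort_eq_iff {α : Type*} [LinearOrder α] {N : ℕ} (w : Fin (N + 1) → α)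
    (σ : Equiv.Perm (Fin (N + 1))) :
    Tuple.sort w = σ ↔ ∀ i : Fin N, (w ∘ σ) i.castSucc ≤ (w ∘ σ) i.succ ∧
      (DescentAt σ i → (w ∘ σ) i.castSucc < (w ∘ σ) i.succ) := by
  rw [eq_comm, Tuple.eq_sort_iff]
  constructor
  · rintro ⟨h1, h2⟩ i
    have hle := h1 i.castSucc_lt_succ.le
    refine ⟨hle, fun ⟨_, hd⟩ => lt_of_le_of_ne hle fun heq => ?_⟩
    exact lt_asymm hd (h2 _ _ i.castSucc_lt_succ heq)
  · intro h
    have hm : Monotone (w ∘ σ) := Fin.monotone_iff_le_succ.2 fun i => (h i).1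
    refine ⟨hm, ?_⟩
    -- Monotonicity forces a tie at distance to be a tie at every position in between, so adjacent
    -- ties suffice.
    have key : ∀ d : ℕ, ∀ i j : Fin (N + 1), (j : ℕ) = i + d + 1 → w (σ i) = w (σ j) →
        σ i < σ j := by
      have step : ∀ i j : Fin (N + 1), (j : ℕ) = i + 1 → w (σ i) = w (σ j) → σ i < σ j := by
        intro i j hij hw
        have hi : (i : ℕ) < N := by omega
        obtain rfl : j = (⟨i, hi⟩ : Fin N).succ := Fin.ext hij
        by_contra hc
        have hne : σ (⟨i, hi⟩ : Fin N).succ ≠ σ i := fun he => by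
          have := congrArg Fin.val (σ.injective he)
          simp at this
        exact hw.not_lt ((h ⟨i, hi⟩).2 ⟨by simpa using hi, lt_of_le_of_ne (not_lt.1 hc) hne⟩)
      intro d
      induction d with
      | zero => exact fun i j hij => step i j (by omega)
      | succ d ih =>
        intro i j hij hw
        have hj : (i : ℕ) + d + 1 < N + 1 := by omega
        have h1 : w (σ i) ≤ w (σ ⟨i + d + 1, hj⟩) := hm (Fin.le_def.2 (by simp; omega))
        have h2 : w (σ ⟨i + d + 1, hj⟩) ≤ w (σ j) := hm (Fin.le_def.2 (by simp; omega))
        exact (ih i ⟨i + d + 1, hj⟩ rfl (le_antisymm h1 (hw ▸ h2))).trans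
          (step _ j (by simp; omega) (le_antisymm h2 (hw ▸ h1)))
    intro i j hij
    exact key (j - i - 1) i j (by rw [Fin.lt_def] at hij; omega)

theorem card_sort_eq {N k : ℕ} (σ : Equiv.Perm (Fin (N + 1))) :
    (Finset.univ.filter fun w : Fin (N + 1) → Fin k => Tuple.sort w = σ).card =
      (k + Nat.count (fun j => ¬ DescentAt σ j) N).choose (N + 1) := by
  rw [← card_monotone_strict_at N k (DescentAt σ)]
  refine Finset.card_equiv (Equiv.arrowCongr σ.symm (Equiv.refl _)) fun w => ?_
  simp only [Finset.mem_filter, Finset.mem_univ, true_and, sort_eq_iff]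
  rfl

/-! ### The left-hand side as a generating function of words -/

/-- Words of length `n` over `k` letters, with `s` marking the weakly increasing windows of
length `m`. -/
noncomputable def wordSum {R : Type*} [CommRing R] (s : R) (m k n : ℕ) : R :=
  ∑ w : Fin n → Fin k, s ^ windowCount m (WeakAscent w) n

theorem wordSum_succ {R : Type*} [CommRing R] (s : R) (m k N : ℕ) :
    wordSum s m k (N + 1) = ∑ π : Equiv.Perm (Fin (N + 1)), s ^ occ (monotonePattern m) π *
      ((k + Nat.count (fun j => ¬ DescentAt π⁻¹ j) N).choose (N + 1) : ℕ) := by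
  classical
  rw [wordSum, ← Finset.sum_fiberwise_of_maps_to (s := Finset.univ) (t := Finset.univ)
    (g := fun w : Fin (N + 1) → Fin k => (Tuple.sort w)⁻¹) (fun _ _ => Finset.mem_univ _)]
  refine Finset.sum_congr rfl fun π _ => ?_
  rw [← card_sort_eq, mul_comm, ← nsmul_eq_mul, ← Finset.sum_const]
  refine Finset.sum_congr (by ext w; simp [inv_eq_iff_eq_inv]) fun w hw => ?_
  rw [occ_monotonePattern]
  congr 1
  refine windowCount_congr fun i _ => ?_
  rw [← weakAscent_sort_symm, (Finset.mem_filter.1 hw).2, inv_inv]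

theorem quo_eq_iff {A : Type*} [CommRing A] {f g h : A} (hg : IsUnit g) :
    quo f g = h ↔ f = h * g := by
  unfold quo
  constructor
  · rintro rfl
    rw [mul_assoc, Ring.inverse_mul_cancel _ hg, mul_one]
  · rintro rfl
    rw [mul_assoc, Ring.mul_inverse_cancel _ hg, mul_one]

theorem quo_one_sub_pow {A : Type*} [CommRing A] (f : A⟦X⟧) (n : ℕ) :
    quo f ((1 - X) ^ (n + 1)) = f * mk fun i => ((n + i).choose n : A) := by
  have h := mk_add_choose_mul_one_sub_pow_eq_one A n
  rw [quo_eq_iff (.of_mul_eq_one_right _ h), mul_assoc, h, mul_one]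

theorem coeff_quo_X_pow {A : Type*} [CommRing A] (k N d e : ℕ) (hd : d + e = N) :
    coeff k (quo ((X : A⟦X⟧) ^ (d + 1)) ((1 - X) ^ (N + 1 + 1))) =
      ((k + e).choose (N + 1) : ℕ) := by
  rw [quo_one_sub_pow, coeff_X_pow_mul']
  split_ifs with h
  · rw [coeff_mk]
    congr 2
    omega
  -- Here `k ≤ d`, so `k + e < N + 1` and the binomial vanishes too.
  · rw [Nat.choose_eq_zero_of_lt (by omega), Nat.cast_zero]

theorem coeff_quo_idesPoly {R : Type*} [CommRing R] {m : ℕ} (hm : 1 ≤ m) (s : R) (k n : ℕ) :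
    coeff k (quo (idesPoly (monotonePattern m) n (C (C s)) (tVar R)) ((1 - tVar R) ^ (n + 1))) =
      C (wordSum s m k n) := by
  cases n with
  | zero =>
    rw [tVar, quo_one_sub_pow]
    simp [idesPoly, wordSum, windowCount_zero hm]
  | succ N =>
    rw [wordSum_succ, idesPoly, if_neg N.succ_ne_zero, map_sum, quo, Finset.sum_mul, map_sum]
    refine Finset.sum_congr rfl fun π _ => ?_
    rw [mul_assoc, ← map_pow, coeff_C_mul, ← map_pow, map_mul C, map_natCast]
    rw [← quo, tVar]
    congr 1
    refine coeff_quo_X_pow k N _ _ ?_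
    rw [ides, des_eq_count, Nat.count_eq_card_filter_range, Nat.count_eq_card_filter_range,
      Finset.card_filter_add_card_filter_not, Finset.card_range]

/-! ### Weakly increasing suffixes and inversion of the word series -/

theorem card_monotone {k : ℕ} (hk : 1 ≤ k) (l : ℕ) [DecidablePred fun v : Fin l → Fin k => Monotone v] :
    (Finset.univ.filter fun v : Fin l → Fin k => Monotone v).card = (k - 1 + l).choose l := by
  cases l with
  | zero => simp [Subsingleton.monotone]
  | succ N =>
    have h := card_sort_eq (k := k) (1 : Equiv.Perm (Fin (N + 1)))
    have hD : ∀ j, ¬ DescentAt (1 : Equiv.Perm (Fin (N + 1))) j := by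
      rintro j ⟨_, h⟩
      simp [Fin.lt_def] at h
    simp only [hD, not_false_eq_true, Nat.count_true] at h
    rw [show k - 1 + (N + 1) = k + N by omega, ← h]
    congr 1
    ext w
    simp only [Finset.mem_filter, Finset.mem_univ, true_and]
    exact Tuple.sort_eq_refl_iff_monotone.symm

theorem monotone_iff_weakAscent {α : Type*} [Preorder α] {n : ℕ} (w : Fin n → α) :
    Monotone w ↔ ∀ j, j + 1 < n → WeakAscent w j := by
  cases n with
  | zero => simp [Subsingleton.monotone]
  | succ n =>
    rw [Fin.monotone_iff_le_succ]
    exact ⟨fun h j hj => ⟨hj, h ⟨j, by omega⟩⟩, fun h i => (h i (by omega)).2⟩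

theorem weakAscent_append_left {α : Type*} [LE α] {p l : ℕ} (u : Fin p → α) (v : Fin l → α)
    {i : ℕ} (hi : i + 1 < p) : WeakAscent (Fin.append u v) i ↔ WeakAscent u i := by
  have h1 : ∀ j (hj : j < p), Fin.append u v ⟨j, by omega⟩ = u ⟨j, hj⟩ := fun j hj =>
    Fin.append_left u v ⟨j, hj⟩
  unfold WeakAscent
  rw [exists_prop_of_true (by omega), exists_prop_of_true hi, h1 i, h1 (i + 1)]

theorem weakAscent_append_right {α : Type*} [LE α] {p l : ℕ} (u : Fin p → α) (v : Fin l → α)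
    {i : ℕ} (hi : i + 1 < l) : WeakAscent (Fin.append u v) (p + i) ↔ WeakAscent v i := by
  have h1 : ∀ j (hj : j < l), Fin.append u v ⟨p + j, by omega⟩ = v ⟨j, hj⟩ := fun j hj =>
    Fin.append_right u v ⟨j, hj⟩
  unfold WeakAscent
  rw [exists_prop_of_true (by omega), exists_prop_of_true hi, h1 i (by omega)]
  exact iff_of_eq (congrArg _ (h1 (i + 1) hi))

open Classical in
-- Concatenation: the binomial counts weakly increasing words `v`, and `w = uv` carries the windows
-- of its prefix `u` only.
theorem choose_mul_wordSum {R : Type*} [CommRing R] (s : R) (m : ℕ) {k : ℕ} (hk : 1 ≤ k)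
    {p l n : ℕ} (h : p + l = n) :
    ((k - 1 + l).choose l : R) * wordSum s m k p =
      ∑ w : Fin n → Fin k, if ∀ j, p ≤ j → j + 1 < n → WeakAscent w j then
        s ^ windowCount m (WeakAscent w) p else 0 := by
  subst h
  rw [← card_monotone hk l, wordSum, Finset.natCast_card_filter, mul_comm, Finset.sum_mul_sum,
    ← Finset.sum_product', Finset.univ_product_univ]
  refine Fintype.sum_equiv (Fin.appendEquiv p l) _ _ fun ⟨u, v⟩ => ?_
  have hl : windowCount m (WeakAscent (Fin.append u v)) p = windowCount m (WeakAscent u) p :=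
    windowCount_congr fun i hi => weakAscent_append_left u v hi
  have hr : Monotone v ↔ ∀ j, p ≤ j → j + 1 < p + l → WeakAscent (Fin.append u v) j := by
    rw [monotone_iff_weakAscent]
    constructor
    · intro h j h1 h2
      obtain ⟨i, rfl⟩ := Nat.exists_eq_add_of_le h1
      exact (weakAscent_append_right u v (by omega)).2 (h i (by omega))
    · exact fun h i hi => (weakAscent_append_right u v hi).1 (h _ (by omega) (by omega))
  simp only [mul_ite, mul_one, mul_zero, Fin.appendEquiv, Equiv.coe_fn_mk, hl, ← hr]

/-- The generating function of words with marked weakly increasing windows, as the inverse of a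
series obtained from the inverse `g` of the generating function of the weights of runs. -/
theorem mk_wordSum_mul_eq_one {R : Type*} [CommRing R] {m : ℕ} (hm : 1 ≤ m) (s : R) {k : ℕ}
    (hk : 1 ≤ k) (g : R⟦X⟧) (hg : g * mk (fun r => s ^ (r + 1 - m)) = 1) :
    mk (fun l => coeff l g * ((k - 1 + l).choose l : R)) * mk (wordSum s m k) = 1 := by
  classical
  ext n
  rw [coeff_mul]
  simp only [coeff_mk]
  rcases eq_or_ne n 0 with rfl | hn
  · have h0 := congrArg (coeff 0) hg
    simp only [coeff_mul, coeff_mk, Finset.HasAntidiagonal.antidiagonal_zero, coeff_zero_one] at h0 ⊢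
    simpa [wordSum, windowCount_zero hm, Nat.sub_eq_zero_of_le hm] using h0
  · rw [coeff_one, if_neg hn]
    have hg' : ∀ r, r ≠ 0 →
        ∑ x ∈ Finset.HasAntidiagonal.antidiagonal r, coeff x.1 g * s ^ (x.2 + 1 - m) = 0 := by
      intro r hr
      have := congrArg (coeff r) hg
      simpa only [coeff_mul, coeff_mk, coeff_one, if_neg hr] using this
    have key : ∀ x ∈ Finset.HasAntidiagonal.antidiagonal n,
        coeff x.1 g * ((k - 1 + x.1).choose x.1 : R) * wordSum s m k x.2 =
        ∑ w : Fin n → Fin k, if ∀ j, x.2 ≤ j → j + 1 < n → WeakAscent w j then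
          coeff x.1 g * s ^ windowCount m (WeakAscent w) x.2 else 0 := by
      intro x hx
      rw [mul_assoc, choose_mul_wordSum s m hk
        ((add_comm _ _).trans (Finset.HasAntidiagonal.mem_antidiagonal.1 hx)), Finset.mul_sum]
      simp only [mul_ite, mul_zero]
    rw [Finset.sum_congr rfl key, Finset.sum_comm]
    exact Finset.sum_eq_zero fun w _ =>
      sum_antidiagonal_run_eq_zero hm s (fun l => coeff l g) hg' (WeakAscent w) hn

/-! ### The series of (a) and (b) in terms of run weights -/

section

variable {R : Type*} [CommRing R]

theorem mk_wordSum_zero {m : ℕ} (hm : 1 ≤ m) (s : R) : mk (wordSum s m 0) = 1 := by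
  ext n
  rw [coeff_mk, coeff_one]
  cases n with
  | zero => simp [wordSum, windowCount_zero hm]
  | succ n => simp [wordSum]

theorem sum_Icc_pow_mul_one_sub {A : Type*} [CommRing A] (y : A) {m : ℕ} (hm : 1 ≤ m) :
    (∑ l ∈ Finset.Icc 1 (m - 1), y ^ l) * (1 - y) = y - y ^ m := by
  obtain ⟨m, rfl⟩ := Nat.exists_eq_add_of_le' hm
  induction m with
  | zero => simp
  | succ m ih =>
    have := ih (by omega)
    rw [Nat.add_sub_cancel] at this ⊢
    rw [Finset.sum_Icc_succ_top (by omega), add_mul, this]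
    ring

/-- The polynomial `1 - (s - 1) (y + ⋯ + y ^ (m - 1))`. -/
def runDenominator {A : Type*} [CommRing A] (m : ℕ) (s y : A) : A :=
  1 - (s - 1) * ∑ l ∈ Finset.Icc 1 (m - 1), y ^ l

theorem runDenominator_mul_one_sub {A : Type*} [CommRing A] {m : ℕ} (hm : 1 ≤ m) (s y : A) :
    runDenominator m s y * (1 - y) = 1 - s * y + (s - 1) * y ^ m := by
  rw [runDenominator, sub_mul, mul_assoc, sum_Icc_pow_mul_one_sub y hm]
  ring

/-- The weights are `1` for `r < m` and geometric with ratio `s` afterwards, so only `1` and the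
terms `1 - s` in degrees `1` to `m - 1` survive. -/
theorem one_sub_mul_mk_run {m : ℕ} (hm : 1 ≤ m) (s : R) :
    (1 - C s * X) * mk (fun r => s ^ (r + 1 - m)) = runDenominator m (C s) (X : R⟦X⟧) := by
  have hs : C s - 1 = C (s - 1) := by rw [map_sub, map_one]
  ext n
  rw [runDenominator, sub_mul, one_mul, mul_assoc, hs, map_sub, map_sub, coeff_C_mul, coeff_C_mul, map_sum]
  simp only [coeff_X_pow, coeff_mk, coeff_one, Finset.sum_ite_eq, Finset.mem_Icc]
  cases n with
  | zero => simp [Nat.sub_eq_zero_of_le hm]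
  | succ n =>
    rw [coeff_succ_X_mul, coeff_mk, if_neg n.succ_ne_zero]
    split_ifs with h
    · rw [Nat.sub_eq_zero_of_le (by omega), Nat.sub_eq_zero_of_le (by omega)]
      ring
    · rw [show n + 1 + 1 - m = (n + 1 - m) + 1 by omega]
      ring

theorem isUnit_runDenominator (m : ℕ) (s : R) :
    IsUnit (runDenominator m (C s) (X : R⟦X⟧)) := by
  rw [PowerSeries.isUnit_iff_constantCoeff, runDenominator]
  have : ∑ l ∈ Finset.Icc 1 (m - 1), (0 : R) ^ l = 0 :=
    Finset.sum_eq_zero fun l hl => zero_pow (by have := Finset.mem_Icc.1 hl; omega)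
  simp [this]

/-- The linear map `x ^ l ↦ t z ^ l / (1 - t)`, where `z = x / (1 - t)`. -/
noncomputable def spread : R⟦X⟧ →+ R⟦X⟧⟦X⟧ where
  toFun g := mk fun k => if k = 0 then 0 else mk fun l => coeff l g * ((k - 1 + l).choose l : R)
  map_zero' := by
    ext k l
    simp only [coeff_mk, map_zero, zero_mul]
    split_ifs <;> simp
  map_add' f g := by
    ext k l
    simp only [coeff_mk, map_add]
    split_ifs
    · simp
    · simp [add_mul]

theorem coeff_spread {k : ℕ} (hk : k ≠ 0) (g : R⟦X⟧) :
    coeff k (spread g) = mk fun l => coeff l g * ((k - 1 + l).choose l : R) := by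
  simp [spread, hk]

theorem coeff_zero_spread (g : R⟦X⟧) : coeff 0 (spread g) = 0 := by
  simp [spread]

theorem spread_C_mul (a : R) (g : R⟦X⟧) : spread (C a * g) = C (C a) * spread g := by
  ext k l
  rcases eq_or_ne k 0 with rfl | hk
  · rw [coeff_zero_spread, coeff_C_mul, coeff_zero_spread, mul_zero]
  · rw [coeff_spread hk, coeff_C_mul, coeff_spread hk, coeff_C_mul, coeff_mk, coeff_mk,
      coeff_C_mul, mul_assoc]

theorem zVar_mul_one_sub : zVar R * (1 - tVar R) = xVar R :=
  ((quo_eq_iff isUnit_one_sub_tVar).1 rfl).symm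

/-- After clearing `1 - t`, this is Pascal's rule for the binomials in `spread`. -/
theorem spread_X_mul (g : R⟦X⟧) : spread (X * g) = zVar R * spread g := by
  rw [← isUnit_one_sub_tVar.mul_left_inj, mul_right_comm, zVar_mul_one_sub, tVar, mul_sub, mul_one,
    xVar]
  ext k l
  rw [coeff_C_mul, map_sub, map_sub]
  cases k with
  | zero => simp [coeff_zero_spread]
  | succ k =>
    rw [coeff_succ_mul_X, coeff_spread k.succ_ne_zero, coeff_spread k.succ_ne_zero, coeff_mk]
    cases l with
    | zero =>
      rcases eq_or_ne k 0 with rfl | hk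
      · simp [coeff_zero_spread]
      · simp [coeff_spread hk]
    | succ l =>
      rw [coeff_succ_X_mul, coeff_succ_X_mul, coeff_mk]
      rcases eq_or_ne k 0 with rfl | hk
      · simp [coeff_zero_spread]
      · rw [coeff_spread hk, coeff_mk, coeff_succ_X_mul, ← mul_sub]
        obtain ⟨k, rfl⟩ := Nat.exists_eq_succ_of_ne_zero hk
        congr 1
        rw [show k.succ + 1 - 1 + (l + 1) = (k + 1 + l) + 1 by omega, Nat.choose_succ_succ,
          show k.succ - 1 + (l + 1) = k + 1 + l by omega,
          show k.succ + 1 - 1 + l = k + 1 + l by omega]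
        push_cast
        ring

theorem spread_X_pow_mul (n : ℕ) (g : R⟦X⟧) : spread (X ^ n * g) = zVar R ^ n * spread g := by
  induction n with
  | zero => simp
  | succ n ih => rw [pow_succ', mul_assoc, spread_X_mul, ih, pow_succ', mul_assoc]

theorem spread_one_mul : spread (1 : R⟦X⟧) * (1 - tVar R) = tVar R := by
  rw [tVar, mul_sub, mul_one]
  ext k l
  rw [map_sub, map_sub]
  cases k with
  | zero => simp [coeff_zero_spread]
  | succ k =>
    rw [coeff_succ_mul_X, coeff_spread k.succ_ne_zero, coeff_mk, coeff_X]
    rcases eq_or_ne k 0 with rfl | hk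
    · simp [coeff_zero_spread]
    · rw [coeff_spread hk, coeff_mk, coeff_one]
      split_ifs with h
      · omega
      · simp [h]
      · omega
      · simp

theorem spread_runDenominator_mul (m : ℕ) (s : R) (g : R⟦X⟧) :
    spread (runDenominator m (C s) X * g) = runDenominator m (C (C s)) (zVar R) * spread g := by
  simp only [runDenominator, sub_mul, one_mul, mul_assoc, Finset.sum_mul, map_sub, map_sum,
    spread_C_mul, spread_X_pow_mul]

/-- With `D` the run denominator, `g = (1 - s x) / D`, hence `1 - g = x + (s - 1) x ^ m / D`; the
two summands spread to the two summands of `occSeries`. -/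
theorem occSeries_eq_spread {m : ℕ} (hm : 1 ≤ m) (s : R) (g : R⟦X⟧)
    (hg : g * mk (fun r => s ^ (r + 1 - m)) = 1) :
    occSeries m (C (C s)) = spread (1 - g) := by
  have hgD : runDenominator m (C s) X * g = 1 - C s * X := by
    rw [← one_sub_mul_mk_run hm, mul_assoc, mul_comm _ g, hg, mul_one]
  have h1 : quo (tVar R * xVar R) ((1 - tVar R) ^ 2) = zVar R * spread 1 := by
    rw [quo_eq_iff (isUnit_one_sub_tVar.pow 2), ← zVar_mul_one_sub]
    linear_combination (-zVar R * (1 - tVar R)) * spread_one_mul (R := R)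
  have h2 : quo ((C (C s) - 1) * tVar R * zVar R ^ m)
      ((1 - tVar R) * (1 - (C (C s) - 1) * ∑ l ∈ Finset.Icc 1 (m - 1), zVar R ^ l)) =
      spread (1 - g - X) := by
    rw [quo_eq_iff (isUnit_occSeries_denominator m _)]
    change _ = _ * (_ * runDenominator m (C (C s)) (zVar R))
    have h3 : runDenominator m (C s) X * (1 - g - X) = C (s - 1) * (X ^ m * 1) := by
      rw [map_sub, map_one]
      linear_combination runDenominator_mul_one_sub hm (C s) (X : R⟦X⟧) - hgD
    have h4 := spread_runDenominator_mul m s (1 - g - X)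
    rw [h3, spread_C_mul, spread_X_pow_mul, map_sub C, map_sub C, map_one, map_one] at h4
    linear_combination (1 - tVar R) * h4 - (C (C s) - 1) * zVar R ^ m * spread_one_mul (R := R)
  rw [occSeries, h1, h2, ← spread_X_mul, ← map_add]
  congr 1
  ring

theorem one_sub_coeff_occSeries_mul {m : ℕ} (hm : 1 ≤ m) (s : R) (k : ℕ) :
    (1 - coeff k (occSeries m (C (C s)))) * mk (wordSum s m k) = 1 := by
  obtain ⟨u, hu⟩ := (isUnit_runDenominator m s).exists_right_inv
  have hg : u * (1 - C s * X) * mk (fun r => s ^ (r + 1 - m)) = 1 := by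
    rw [mul_assoc, one_sub_mul_mk_run hm, mul_comm, hu]
  rw [occSeries_eq_spread hm s _ hg]
  -- For `k = 0` the alphabet is empty, so only the empty word remains.
  rcases eq_or_ne k 0 with rfl | hk
  · rw [coeff_zero_spread, sub_zero, one_mul, mk_wordSum_zero hm]
  · refine Eq.trans (congrArg (· * _) ?_)
      (mk_wordSum_mul_eq_one hm s (Nat.one_le_iff_ne_zero.2 hk) _ hg)
    ext l
    rw [coeff_spread hk, map_sub, coeff_mk, coeff_mk, map_sub, coeff_one, sub_mul, sub_eq_iff_eq_add,
      add_sub_cancel]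
    split_ifs with h <;> simp [h]

theorem constantCoeff_mk_wordSum {m : ℕ} (hm : 1 ≤ m) (s : R) (k : ℕ) :
    constantCoeff (mk (wordSum s m k)) = 1 := by
  simp [← coeff_zero_eq_constantCoeff_apply, wordSum, windowCount_zero hm]

theorem constantCoeff_coeff_occSeries {m : ℕ} (hm : 1 ≤ m) (s : R) (k : ℕ) :
    constantCoeff (coeff k (occSeries m (C (C s)))) = 0 := by
  have := congrArg constantCoeff (one_sub_coeff_occSeries_mul hm s k)
  rw [map_mul, constantCoeff_mk_wordSum hm, mul_one, map_sub, map_one] at this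
  linear_combination -this

/-! ### Formal sums and Hadamard powers -/

theorem coeff_hadamardPow {A : Type*} [CommRing A] (f : A⟦X⟧) (k n : ℕ) :
    coeff k (hadamardPow f n) = coeff k f ^ n := by
  induction n with
  | zero => simp [hadamardPow]
  | succ n ih => simp [hadamardPow, hadamard, ih, pow_succ]

theorem coeff_pow_eq_zero {a : R⟦X⟧} (ha : constantCoeff a = 0) {j n : ℕ} (h : j < n) :
    coeff j (a ^ n) = 0 :=
  PowerSeries.X_pow_dvd_iff.1 (pow_dvd_pow_of_dvd (PowerSeries.X_dvd_iff.2 ha) n) j h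

theorem finsum_coeff_pow {a w : R⟦X⟧} (ha : constantCoeff a = 0) (hw : (1 - a) * w = 1) (j : ℕ) :
    ∑ᶠ n, coeff j (a ^ n) = coeff j w := by
  -- Truncated geometric series: the remainder is divisible by `X ^ (j + 1)` and does not reach the
  -- coefficient `j`.
  have h : w = ∑ n ∈ Finset.range (j + 1), a ^ n + a ^ (j + 1) * w := by
    linear_combination (∑ n ∈ Finset.range (j + 1), a ^ n) * hw + w * geom_sum_mul a (j + 1)
  have h0 : coeff j (a ^ (j + 1) * w) = 0 := PowerSeries.X_pow_dvd_iff.1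
    ((pow_dvd_pow_of_dvd (PowerSeries.X_dvd_iff.2 ha) _).mul_right w) j j.lt_succ_self
  rw [h, map_add, h0, add_zero, map_sum]
  refine finsum_eq_sum_of_support_subset _ fun n hn => ?_
  by_contra hc
  exact hn (coeff_pow_eq_zero ha (by simpa using hc))

theorem coeff_idesTerm {m : ℕ} (hm : 1 ≤ m) (s : R) (k j n : ℕ) :
    coeff j (coeff k (idesTerm m (C (C s)) n)) = if j = n then wordSum s m k n else 0 := by
  rw [idesTerm, xVar, ← map_pow, coeff_mul_C, coeff_quo_idesPoly hm, coeff_C_mul, coeff_X_pow]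
  simp

theorem summable_idesTerm {m : ℕ} (hm : 1 ≤ m) (s : R) :
    Summable₂ (fun n => idesTerm m (C (C s)) n) := by
  refine fun k j => (Set.finite_singleton j).subset fun n hn => ?_
  rw [Function.mem_support, coeff_idesTerm hm] at hn
  exact (ite_ne_right_iff.1 hn).1.symm

theorem formalSum_idesTerm {m : ℕ} (hm : 1 ≤ m) (s : R) :
    formalSum₂ (fun n => idesTerm m (C (C s)) n) = mk fun k => mk (wordSum s m k) := by
  ext k j
  simp only [formalSum₂, coeff_mk, coeff_idesTerm hm]
  rw [finsum_eq_single _ j fun n hn => if_neg hn.symm, if_pos rfl]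

theorem summable_hadamardPow {f : R⟦X⟧⟦X⟧} (hf : ∀ k, constantCoeff (coeff k f) = 0) :
    Summable₂ (fun n => hadamardPow f n) := by
  refine fun k j => (Set.finite_Iic j).subset fun n hn => ?_
  by_contra hc
  refine hn ?_
  change coeff j (coeff k (hadamardPow f n)) = 0
  rw [coeff_hadamardPow, coeff_pow_eq_zero (hf k) (not_le.1 hc)]

theorem formalSum_hadamardPow_occSeries {m : ℕ} (hm : 1 ≤ m) (s : R) :
    formalSum₂ (fun n => hadamardPow (occSeries m (C (C s))) n) =
      mk fun k => mk (wordSum s m k) := by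
  ext k j
  simp only [formalSum₂, coeff_mk, coeff_hadamardPow]
  rw [finsum_coeff_pow (constantCoeff_coeff_occSeries hm s k)
    (one_sub_coeff_occSeries_mul hm s k), coeff_mk]

/-- At `s = 0` the run denominator times `1 - z` is `1 - z ^ m`, and `z - z ^ m (1 - z) / (1 - z ^
m) = (z - z ^ m) / (1 - z ^ m)`. -/
theorem avoidSeries_eq_occSeries {m : ℕ} (hm : 1 ≤ m) : avoidSeries R m = occSeries m 0 := by
  have hD := runDenominator_mul_one_sub hm 0 (zVar R)
  have hu := isUnit_occSeries_denominator (R := R) m 0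
  rw [avoidSeries, quo_eq_iff (isUnit_avoidSeries_denominator m (by omega)), occSeries]
  have h1 : quo (tVar R * xVar R) ((1 - tVar R) ^ 2) * (1 - tVar R) = tVar R * zVar R := by
    rw [← isUnit_one_sub_tVar.mul_left_inj, mul_assoc, ← sq,
      ← (quo_eq_iff (isUnit_one_sub_tVar.pow 2)).1 rfl, ← zVar_mul_one_sub]
    ring
  have h2 := (quo_eq_iff (f := ((0 : R⟦X⟧⟦X⟧) - 1) * tVar R * zVar R ^ m) hu).1 rfl
  rw [show 1 - ((0 : R⟦X⟧⟦X⟧) - 1) * ∑ l ∈ Finset.Icc 1 (m - 1), zVar R ^ l =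
    runDenominator m 0 (zVar R) from rfl] at h2 ⊢
  have hz : zVar R * zVar R ^ (m - 1) = zVar R ^ m := mul_pow_sub_one (by omega) _
  linear_combination (-(1 - zVar R ^ m)) * h1 + (1 - zVar R) * h2 - tVar R * hz +
    quo (((0 : R⟦X⟧⟦X⟧) - 1) * tVar R * zVar R ^ m)
      ((1 - tVar R) * runDenominator m 0 (zVar R)) * (1 - tVar R) * hD

end

/-! ### Avoidance: the explicit binomial series of (c) -/

/-- The series `∑ j, (x ^ (j m) - x ^ (j m + 1))`. -/
def alternatingSeries (m : ℕ) : ℚ⟦X⟧ :=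
  mk fun l => if l % m = 0 then 1 else if l % m = 1 then -1 else 0

theorem alternatingSeries_mul {m : ℕ} (hm : 2 ≤ m) :
    alternatingSeries m * (1 - X ^ m) = 1 - X := by
  ext n
  rw [mul_sub, mul_one, map_sub, map_sub, coeff_mul_X_pow', coeff_one, coeff_X, alternatingSeries,
    coeff_mk]
  by_cases h : m ≤ n
  · rw [if_pos h, coeff_mk, ← Nat.mod_eq_sub_mod h, if_neg (by omega : n ≠ 0),
      if_neg (by omega : n ≠ 1)]
    ring
  · rw [if_neg h, Nat.mod_eq_of_lt (not_le.1 h)]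
    split_ifs <;> first | omega | simp

/-- At `s = 0` the run weights are `1 + x + ⋯ + x ^ (m - 1)`, whose inverse is `(1 - x) / (1 - x ^
m)`; this is the `g` used for (c). -/
theorem alternatingSeries_mul_run {m : ℕ} (hm : 2 ≤ m) :
    alternatingSeries m * mk (fun r => (0 : ℚ) ^ (r + 1 - m)) = 1 := by
  have h1 := one_sub_mul_mk_run (by omega : 1 ≤ m) (0 : ℚ)
  have h2 := runDenominator_mul_one_sub (by omega : 1 ≤ m) (C (0 : ℚ)) (X : ℚ⟦X⟧)
  have hX : (1 - X : ℚ⟦X⟧) ≠ 0 := fun h => by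
    simpa using congrArg constantCoeff h
  rw [map_zero] at h1 h2
  refine mul_right_cancel₀ hX ?_
  linear_combination alternatingSeries m * (1 - X) * h1 + alternatingSeries m * h2 +
    alternatingSeries_mul hm

theorem coeff_binomTerm (m k j l : ℕ) : coeff l (binomTerm m k j) =
    (if l = j * m then ((k + j * m - 1).choose (k - 1) : ℚ) else 0) -
      if l = j * m + 1 then ((k + j * m).choose (k - 1) : ℚ) else 0 := by
  rw [binomTerm, map_sub, ← map_natCast C, ← map_natCast C, coeff_C_mul, coeff_C_mul, coeff_X_pow,
    coeff_X_pow, mul_ite, mul_one, mul_zero, mul_ite, mul_one, mul_zero]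

theorem coeff_binomTerm_of_ne {m : ℕ} (hm : 2 ≤ m) (k : ℕ) {j l : ℕ} (h : j ≠ l / m) :
    coeff l (binomTerm m k j) = 0 := by
  rw [coeff_binomTerm, if_neg, if_neg, sub_zero]
  · rintro rfl
    rw [mul_comm, Nat.mul_add_div (by omega), Nat.div_eq_of_lt (by omega)] at h
    exact h rfl
  · rintro rfl
    exact h (Nat.mul_div_cancel _ (by omega)).symm

theorem summable_binomTerm {m : ℕ} (hm : 2 ≤ m) (k : ℕ) :
    Summable₁ (fun j => binomTerm m k j) := fun l =>
  (Set.finite_singleton (l / m)).subset fun _ hj => by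
    by_contra hc
    exact hj (coeff_binomTerm_of_ne hm k hc)

theorem formalSum_binomTerm {m k : ℕ} (hm : 2 ≤ m) (hk : 1 ≤ k) :
    formalSum₁ (fun j => binomTerm m k j) =
      mk fun l => coeff l (alternatingSeries m) * ((k - 1 + l).choose l : ℚ) := by
  ext l
  rw [formalSum₁, coeff_mk, coeff_mk, finsum_eq_single _ (l / m) fun j hj =>
    coeff_binomTerm_of_ne hm k hj, coeff_binomTerm, alternatingSeries, coeff_mk]
  have hl := Nat.div_add_mod' l m
  set q := l / m * m
  have hc : (k - 1 + l).choose l = (k - 1 + l).choose (k - 1) := (Nat.choose_symm_add).symm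
  rw [hc]
  split_ifs with h1 h2 h3 h4 h5 h6 <;> try omega
  · rw [show k + q - 1 = k - 1 + l by omega]; simp
  · rw [show k + q = k - 1 + l by omega]; simp
  · simp

theorem formalSum_binomTerm_mul {m k : ℕ} (hm : 2 ≤ m) (hk : 1 ≤ k) :
    formalSum₁ (fun j => binomTerm m k j) * mk (wordSum 0 m k) = 1 := by
  rw [formalSum_binomTerm hm hk]
  exact mk_wordSum_mul_eq_one (by omega) 0 hk _ (alternatingSeries_mul_run hm)

theorem inv_formalSum_binomTerm {m k : ℕ} (hm : 2 ≤ m) (hk : 1 ≤ k) :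
    (formalSum₁ (fun j => binomTerm m k j))⁻¹ = mk (wordSum 0 m k) := by
  have h := formalSum_binomTerm_mul hm hk
  refine (PowerSeries.eq_inv_iff_mul_eq_one ?_).2 ((mul_comm _ _).trans h) |>.symm
  intro h0
  simpa [h0] using congrArg constantCoeff h

theorem idesAvoidTerm_eq (m n : ℕ) : idesAvoidTerm ℚ m n = idesTerm m (C (C 0)) n := by
  rw [map_zero, map_zero]
  rfl

theorem coeff_C_mul_tVar_pow (a : ℚ⟦X⟧) (k n : ℕ) :
    coeff k (C a * tVar ℚ ^ n) = if k = n then a else 0 := by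
  rw [tVar, coeff_C_mul, coeff_X_pow, mul_ite, mul_one, mul_zero]

theorem summable_C_mul_tVar_pow (a : ℕ → ℚ⟦X⟧) :
    Summable₂ (fun k => C (a k) * tVar ℚ ^ (k + 1)) := by
  refine fun k j => (Set.finite_singleton (k - 1)).subset fun n hn => ?_
  by_contra hc
  refine hn ?_
  have : k ≠ n + 1 := fun h => hc (by simp [h])
  change coeff j (coeff k (C (a n) * tVar ℚ ^ (n + 1))) = 0
  rw [coeff_C_mul_tVar_pow, if_neg this, map_zero]

theorem one_add_formalSum_C_mul_tVar_pow (a : ℕ → ℚ⟦X⟧) (ha : a 0 = 1) :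
    1 + formalSum₂ (fun k => C (a (k + 1)) * tVar ℚ ^ (k + 1)) = mk a := by
  ext k j
  rw [map_add, map_add, formalSum₂, coeff_mk, coeff_mk, coeff_mk, coeff_one]
  simp only [coeff_C_mul_tVar_pow]
  cases k with
  | zero => simp [ha]
  | succ k =>
    rw [finsum_eq_single _ k fun n hn => by rw [if_neg (by omega), map_zero]]
    simp

end ConsecutivePatterns

theorem theorem4p3 (m : ℕ) (hm : 2 ≤ m) :
    -- (a) all permutations, with `s` tracking the occurrences of `12⋯m`, in `ℚ⟦s,x,t⟧`
    (ConsecutivePatterns.Summable₂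
        (fun n => ConsecutivePatterns.idesTerm m ConsecutivePatterns.sVar n) ∧
      ConsecutivePatterns.Summable₂
        (fun n => ConsecutivePatterns.hadamardPow
          (ConsecutivePatterns.occSeries m ConsecutivePatterns.sVar) n) ∧
      ConsecutivePatterns.formalSum₂
          (fun n => ConsecutivePatterns.idesTerm m ConsecutivePatterns.sVar n) =
        ConsecutivePatterns.formalSum₂
          (fun n => ConsecutivePatterns.hadamardPow
            (ConsecutivePatterns.occSeries m ConsecutivePatterns.sVar) n)) ∧
    -- (b) permutations avoiding `12⋯m`, in `ℚ⟦x,t⟧`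
    (ConsecutivePatterns.Summable₂ (fun n => ConsecutivePatterns.idesAvoidTerm ℚ m n) ∧
      ConsecutivePatterns.Summable₂
        (fun n => ConsecutivePatterns.hadamardPow (ConsecutivePatterns.avoidSeries ℚ m) n) ∧
      ConsecutivePatterns.formalSum₂ (fun n => ConsecutivePatterns.idesAvoidTerm ℚ m n) =
        ConsecutivePatterns.formalSum₂
          (fun n => ConsecutivePatterns.hadamardPow (ConsecutivePatterns.avoidSeries ℚ m) n)) ∧
    -- (c) permutations avoiding `12⋯m`, without Hadamard products; the summation index `k ≥ 1` of
    -- the outer sum is written as `k + 1` with `k ≥ 0`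
    ((∀ k : ℕ, 1 ≤ k →
        ConsecutivePatterns.Summable₁ (fun j => ConsecutivePatterns.binomTerm m k j) ∧
        IsUnit (ConsecutivePatterns.formalSum₁
          (fun j => ConsecutivePatterns.binomTerm m k j))) ∧
      ConsecutivePatterns.Summable₂
        (fun k => PowerSeries.C (ConsecutivePatterns.formalSum₁
            (fun j => ConsecutivePatterns.binomTerm m (k + 1) j))⁻¹ *
          ConsecutivePatterns.tVar ℚ ^ (k + 1)) ∧
      ConsecutivePatterns.formalSum₂ (fun n => ConsecutivePatterns.idesAvoidTerm ℚ m n) =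
        1 + ConsecutivePatterns.formalSum₂
          (fun k => PowerSeries.C (ConsecutivePatterns.formalSum₁
              (fun j => ConsecutivePatterns.binomTerm m (k + 1) j))⁻¹ *
            ConsecutivePatterns.tVar ℚ ^ (k + 1))) := by
  open ConsecutivePatterns in
  have hm1 : 1 ≤ m := by omega
  have hs : sVar = C (C PowerSeries.X) := rfl
  have h0 : (0 : ℚ⟦X⟧⟦X⟧) = C (C 0) := by rw [map_zero, map_zero]
  have hinv : ∀ k : ℕ, (formalSum₁ (fun j => binomTerm m (k + 1) j))⁻¹ =
      mk (wordSum 0 m (k + 1)) := fun k => inv_formalSum_binomTerm hm k.succ_pos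
  -- All parts now concern a doubly constant `s`: the variable of `ℚ⟦X⟧` in (a), and `0` in `ℚ` in
  -- (b) and (c).
  simp only [hs, idesAvoidTerm_eq, avoidSeries_eq_occSeries hm1, h0, hinv]
  refine ⟨⟨summable_idesTerm hm1 _,
      summable_hadamardPow (constantCoeff_coeff_occSeries hm1 _),
      (formalSum_idesTerm hm1 _).trans (formalSum_hadamardPow_occSeries hm1 _).symm⟩,
    ⟨summable_idesTerm hm1 _,
      summable_hadamardPow (constantCoeff_coeff_occSeries hm1 _),
      (formalSum_idesTerm hm1 _).trans (formalSum_hadamardPow_occSeries hm1 _).symm⟩,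
    fun k hk => ⟨summable_binomTerm hm k, .of_mul_eq_one _ (formalSum_binomTerm_mul hm hk)⟩,
    summable_C_mul_tVar_pow _, ?_⟩
  rw [formalSum_idesTerm hm1, one_add_formalSum_C_mul_tVar_pow (fun k => mk (wordSum 0 m k))
    (mk_wordSum_zero hm1 0)]
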